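/- **Setting.** A directed hypergraph $H=(V,E)$ has a finite vertex set $V=\{1,\dots,n\}$ and a nonempty finite set $E$ of directed edges. An edge $e$ is a subset of $V$ with a partition $e=T_e\sqcup H_e$ into a nonempty tail $T_e$ and a nonempty head $H_e$; distinct edges are distinct as subsets of $V$. The edges need not all have the same size. Let $d^+(i)=|\{e\in E: i\in T_e\}|$, let $\delta^+$ and $\Delta^+$ be the minimum and maximum of $d^+$ over $V$, and let $m=\max_{e\in E}|e|$ be the rank of $H$. The out-adjacency hypermatrix $A_H^+=(a^+_{p_1\dots p_m})$ has order $m$ and dimension $n$. For an edge $e$ with $|e|=s$ and $|T_e|=k$, put $a^+_{p_1\dots p_m}=k/\alpha$ whenever, for some $t$ with $k\le t\le m-s+k$, $\{p_1,\dots,p_t\}=T_e$ and $\{p_{t+1},\dots,p_m\}=H_e$, where $$\alpha=\sum_{r=0}^{m-s}\Bigl(\sum_{\substack{t_1,\dots,t_k\ge1\\ \sum t_i=r+k}}\frac{(r+k)!}{t_1!\cdots t_k!}\Bigr)\Bigl(\sum_{\substack{t_1,\dots,t_{s-k}\ge1\\ \sum t_i=m-k-r}}\frac{(m-k-r)!}{t_1!\cdots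 t_{s-k}!}\Bigr);$$ all other entries are $0$. Let $D_H^+$ be the diagonal hypermatrix of order $m$ with $d_{ii\dots i}=d^+(i)$, and let $\mathbb L_H^+=D_H^++A_H^+$. For a hypermatrix $A$ of order $m$ and dimension $n$, a pair $(\lambda,x)\in\mathbb C\times(\mathbb C^n\setminus\{0\})$ is an eigenpair, and $\lambda$ an eigenvalue, if $\sum_{i_2,\dots,i_m}a_{ii_2\dots i_m}x_{i_2}\cdots x_{i_m}=\lambda x_i^{m-1}$ for all $i$; $\lambda\in\mathbb R$ is an H-eigenvalue if it has a real eigenvector; $\rho(A)$ is the maximum of $|\lambda|$ over all eigenvalues. Let $\mathbf 1_i$ be the $i$-th standard basis vector. **Theorem.** Let $H$ be a directed hypergraph as above. 1. If $m\ge3$, then $(d^+(i),\mathbf 1_i)$ is an eigenpair of $\mathbb L_H^+$ for every vertex $i$ such that no edge with exactly two vertices has head $\{i\}$ (hence for every vertex, if every edge has at least three vertices). 2. The maximum $\rho(\mathbb L_H^+)$ exists, and $2\delta^+\le\rho(\mathbb L_H^+)\le2\Delta^+$. 3. Suppose $m\ge3$. The set of real eigenvalues of $\mathbb L_H^+$ has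 a minimum $\lambda_{\min}$ and a maximum $\lambda_{\max}$, and $0\le\lambda_{\min}$ and $\delta^+\le\Delta^+\le\lambda_{\max}\le2\Delta^+$. If moreover some vertex $i$ with $d^+(i)=\delta^+$ is such that no edge with exactly two vertices has head $\{i\}$ (in particular, if every edge has at least three vertices), then $0\le\lambda_{\min}\le\delta^+\le\Delta^+\le\lambda_{\max}\le2\Delta^+$. The same holds with the set of H-eigenvalues in place of the set of real eigenvalues. 4. If all edges have the same number $m$ of vertices, $m$ is even, and $\bigcap_{e\in E}e\neq\emptyset$, then $0$ is an eigenvalue of $\mathbb L_H^+$. 5. If $d^+(i)=k$ for every vertex $i$, then $2k$ is an eigenvalue of $\mathbb L_H^+$. -/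

import Mathlib

open Finset

/-- A real hypermatrix (tensor) of order `m` whose indices range over `V`. -/
abbrev Hypermatrix (V : Type*) (m : ℕ) : Type _ := (Fin m → V) → ℝ

namespace Hypermatrix

variable {V : Type*} [Fintype V] [DecidableEq V] {m : ℕ}

/-- The vector `A x` (also written `A x^{m-1}`): its `i`-th entry is the sum of
`a_{i i₂ … i_m} x_{i₂} ⋯ x_{i_m}` over all `i₂, …, i_m`, that is, over all index tuples
with first entry `i`. -/
noncomputable def apply (A : Hypermatrix V m) (x : V → ℂ) (i : V) : ℂ :=
  ∑ p : Fin m → V with ∀ j : Fin m, j.val = 0 → p j = i,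
    (A p : ℂ) * ∏ j : Fin m with j.val ≠ 0, x (p j)

/-- `(c, x)` is an eigenpair of `A`: `x ≠ 0` and `A x^{m-1} = c x^{[m-1]}`. -/
def IsEigenpair (A : Hypermatrix V m) (c : ℂ) (x : V → ℂ) : Prop :=
  x ≠ 0 ∧ ∀ i, A.apply x i = c * x i ^ (m - 1)

/-- `c` is an eigenvalue of `A`. -/
def IsEigenvalue (A : Hypermatrix V m) (c : ℂ) : Prop :=
  ∃ x : V → ℂ, A.IsEigenpair c x

/-- The real number `c` is an H-eigenvalue of `A`: it has a real eigenvector. -/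
def IsHEigenvalue (A : Hypermatrix V m) (c : ℝ) : Prop :=
  ∃ x : V → ℝ, A.IsEigenpair (c : ℂ) (fun i => (x i : ℂ))

/-- The set of absolute values of the eigenvalues of `A`. -/
def eigenvalueModuli (A : Hypermatrix V m) : Set ℝ :=
  {r | ∃ c : ℂ, A.IsEigenvalue c ∧ r = ‖c‖}

/-- The spectral radius `ρ(A)`. -/
noncomputable def spectralRadius (A : Hypermatrix V m) : ℝ :=
  sSup A.eigenvalueModuli

end Hypermatrix

/-- A directed hyperedge on `V`: a vertex set partitioned into a nonempty tail
and a nonempty head. -/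
structure DirectedEdge (V : Type*) where
  tail : Finset V
  head : Finset V
  tail_nonempty : tail.Nonempty
  head_nonempty : head.Nonempty
  disjoint : Disjoint tail head

namespace DirectedEdge

variable {V : Type*} [DecidableEq V]

/-- The set of all vertices of the edge. -/
def verts (e : DirectedEdge V) : Finset V := e.tail ∪ e.head

/-- `Σ N! / (t₁! ⋯ t_k!)` over all `t₁, …, t_k ≥ 1` with `t₁ + ⋯ + t_k = N`. -/
def positiveMultinomialSum (k N : ℕ) : ℕ :=
  ∑ t ∈ (Finset.univ : Finset (Fin k)).piAntidiag N with ∀ i, 1 ≤ t i,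
    Nat.multinomial Finset.univ t

/-- The normalizing constant `α` of an edge with `s` vertices, `k` of them in the tail,
in a hypergraph of rank `m`. -/
def alpha (m s k : ℕ) : ℕ :=
  ∑ r ∈ Finset.range (m - s + 1),
    positiveMultinomialSum k (r + k) * positiveMultinomialSum (s - k) (m - k - r)

/-- The index tuple `p = (p₁, …, p_m)` belongs to the edge `e`: for some `t` with
`k ≤ t ≤ m - s + k` (`s` the number of vertices of `e`, `k` of them in the tail) the
entries `p₁, …, p_t` are tail vertices and each tail vertex occurs among them, and
`p_{t+1}, …, p_m` are head vertices and each head vertex occurs among them. -/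
def Fits (e : DirectedEdge V) {m : ℕ} (p : Fin m → V) : Prop :=
  ∃ t ∈ Finset.Icc e.tail.card (m - e.verts.card + e.tail.card),
    (Finset.univ.filter fun j : Fin m => (j : ℕ) < t).image p = e.tail ∧
    (Finset.univ.filter fun j : Fin m => t ≤ (j : ℕ)).image p = e.head

instance (e : DirectedEdge V) {m : ℕ} (p : Fin m → V) : Decidable (e.Fits p) := by
  unfold Fits
  infer_instance

end DirectedEdge

/-- A (not necessarily uniform) directed hypergraph with vertex set `V`: a finite set of
directed edges, distinct edges having distinct vertex sets. -/
structure DirectedHypergraph (V : Type*) [DecidableEq V] where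
  edges : Finset (DirectedEdge V)
  verts_injOn : ∀ e ∈ edges, ∀ f ∈ edges, e.verts = f.verts → e = f

namespace DirectedHypergraph

variable {V : Type*} [DecidableEq V]

/-- The out-degree `d⁺(v)`: the number of edges with `v` in the tail. -/
def outDegree (H : DirectedHypergraph V) (v : V) : ℕ :=
  (H.edges.filter fun e => v ∈ e.tail).card

/-- The smallest out-degree `δ⁺`. -/
def minOutDegree [Fintype V] [Nonempty V] (H : DirectedHypergraph V) : ℕ :=
  Finset.univ.inf' Finset.univ_nonempty H.outDegree

/-- The largest out-degree `Δ⁺`. -/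
def maxOutDegree [Fintype V] [Nonempty V] (H : DirectedHypergraph V) : ℕ :=
  Finset.univ.sup' Finset.univ_nonempty H.outDegree

/-- The rank of `H`: the maximum cardinality of an edge. -/
def rank (H : DirectedHypergraph V) : ℕ :=
  H.edges.sup fun e => e.verts.card

/-- `H` is `m`-uniform: every edge has exactly `m` vertices. -/
def IsUniform (H : DirectedHypergraph V) (m : ℕ) : Prop :=
  ∀ e ∈ H.edges, e.verts.card = m

/-- `H` is `k`-out-regular: every vertex has out-degree `k`. -/
def IsOutRegular (H : DirectedHypergraph V) (k : ℕ) : Prop :=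
  ∀ v, H.outDegree v = k

/-- The out-adjacency hypermatrix, in order `m` (it is used for `m` the rank of `H`). The entry
at `p` is `k / α` for the edge to which `p` belongs, and zero if there is none. There is at
most one such edge, since the entries of `p` form its vertex set. -/
noncomputable def outAdjacency (H : DirectedHypergraph V) (m : ℕ) : Hypermatrix V m := fun p =>
  ∑ e ∈ H.edges,
    if e.Fits p then
      (e.tail.card : ℝ) / (DirectedEdge.alpha m e.verts.card e.tail.card : ℝ)
    else 0

/-- The out-degree hypermatrix, in order `m`: the diagonal hypermatrix with
diagonal entries `d⁺(i)`. -/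
noncomputable def outDegreeHypermatrix [Fintype V] (H : DirectedHypergraph V) (m : ℕ) :
    Hypermatrix V m := fun p =>
  ∑ i : V, if ∀ j, p j = i then (H.outDegree i : ℝ) else 0

/-- The out-signless Laplacian hypermatrix, whose order is the rank of `H`. -/
noncomputable def outSignlessLaplacian [Fintype V] (H : DirectedHypergraph V) :
    Hypermatrix V H.rank :=
  H.outDegreeHypermatrix H.rank + H.outAdjacency H.rank

/-- No edge with exactly two vertices has the vertex `i` as its head. -/
def NotTwoVertexHead (H : DirectedHypergraph V) (i : V) : Prop :=
  ∀ e ∈ H.edges, e.verts.card = 2 → e.head ≠ {i}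

end DirectedHypergraph

/-!
For each edge and each of its tail vertices `i`, the number of index tuples of the edge that start
at `i` does not depend on `i`, and there are `α` tuples in total. The weight `k / α` therefore makes
the row sums of `A⁺` equal to the out-degrees, and the out-signless Laplacian is `D + A⁺` with `D`
the diagonal of the row sums of the nonnegative hypermatrix `A⁺`.

Gershgorin's theorem places every eigenvalue in a disc of centre and radius `d⁺(i)`, which gives
the upper bounds and `0 ≤ λ_min`. For the lower bounds, a nonnegative hypermatrix has a real
eigenvector whose eigenvalue is at least every `c` with `c x^{[m-1]} ≤ L x` for some nonnegative
`x ≠ 0` (Collatz–Wielandt, reached by perturbing to positive hypermatrices); the test vectors are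
the all-ones vector and the standard basis vectors. In the uniform case of even order, a sign vector
`x` whose product over every edge is `-1` satisfies `A⁺ x = -D x^{[m-1]}`, so that `0` is an
eigenvalue.
-/

open Filter Topology

theorem isClosed_setOf_exists_mem_of_isCompact {X Y : Type*} [TopologicalSpace X]
    [TopologicalSpace Y] {K : Set X} (hK : IsCompact K) {C : Set (X × Y)} (hC : IsClosed C) :
    IsClosed {y | ∃ x ∈ K, (x, y) ∈ C} := by
  have : CompactSpace K := isCompact_iff_compactSpace.1 hK
  convert isClosedMap_snd_of_compactSpace _
    (hC.preimage (continuous_subtype_val.prodMap continuous_id : Continuous (Prod.map _ _ :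
      K × Y → X × Y)))
  ext y
  simp

theorem exists_norm_apply_eq_one {ι E : Type*} [Fintype ι] [SeminormedAddGroup E] {x : ι → E}
    (hx : ‖x‖ = 1) : ∃ i, ‖x i‖ = 1 := by
  have : Nonempty ι := by
    by_contra h
    rw [not_nonempty_iff] at h
    simp [Pi.norm_def] at hx
  obtain ⟨i, hi⟩ := Finite.exists_max fun i => ‖x i‖
  exact ⟨i, hx ▸ (norm_le_pi_norm x i).antisymm
    ((pi_norm_le_iff_of_nonneg (norm_nonneg _)).2 hi)⟩

theorem card_filter_val_ne_zero (m : ℕ) : #{j : Fin m | (j : ℕ) ≠ 0} = m - 1 := by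
  cases m with
  | zero => simp
  | succ n => simp [Fin.val_eq_zero_iff, filter_ne']

theorem mul_prod_filter_val_ne_zero {M : Type*} [CommMonoid M] {m : ℕ} {z : Fin m}
    (hz : z.val = 0) (f : Fin m → M) : f z * ∏ j : Fin m with j.val ≠ 0, f j = ∏ j, f j := by
  have hfilter : ({j : Fin m | j.val ≠ 0} : Finset (Fin m)) = univ.erase z := by
    simp only [← hz, ← Fin.ext_iff.not, filter_ne' univ z]
  rw [hfilter, mul_prod_erase univ f (mem_univ z)]

theorem forall_val_eq_zero_imp_iff {m : ℕ} {P : Fin m → Prop} {z : Fin m} (hz : z.val = 0) :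
    (∀ j : Fin m, j.val = 0 → P j) ↔ P z :=
  ⟨fun h => h z hz, fun h j hj => by rwa [Fin.ext (hj.trans hz.symm)]⟩

namespace Hypermatrix

/-- The index tuple `(j, i, …, i)` of length `m`. -/
def consConst {V : Type*} (m : ℕ) (j i : V) : Fin m → V := fun l => if l.val = 0 then j else i

theorem consConst_self {V : Type*} (m : ℕ) (i : V) : consConst m i i = fun _ => i :=
  funext fun _ => ite_self i

theorem prod_consConst {V M : Type*} [CommMonoid M] (m : ℕ) (x : V → M) (j i : V) :
    ∏ l : Fin m with l.val ≠ 0, x (consConst m j i l) = x i ^ (m - 1) := by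
  rw [← card_filter_val_ne_zero m, ← prod_const]
  exact prod_congr rfl fun l hl => by rw [consConst, if_neg (mem_filter.1 hl).2]

variable {V : Type*} [Fintype V] [DecidableEq V] {m : ℕ}

section Algebra

variable {R : Type*} [CommRing R] [Algebra ℝ R]

/-- The vector `A x^{m-1}` over an arbitrary commutative `ℝ`-algebra, so that real and complex
eigenvectors are treated together. -/
noncomputable def applyOver (A : Hypermatrix V m) (x : V → R) (i : V) : R :=
  ∑ p : Fin m → V with ∀ j : Fin m, j.val = 0 → p j = i,
    A p • ∏ j : Fin m with j.val ≠ 0, x (p j)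

variable (R) in
/-- The set of eigenvalues of `A` that have an eigenvector over `R`. -/
def eigenvalueSet (A : Hypermatrix V m) : Set R :=
  {c | ∃ x : V → R, x ≠ 0 ∧ ∀ i, A.applyOver x i = c * x i ^ (m - 1)}

/-- The sum of all entries of `A` whose first index is `i`. -/
noncomputable def rowSum (A : Hypermatrix V m) (i : V) : ℝ :=
  ∑ p : Fin m → V with ∀ j : Fin m, j.val = 0 → p j = i, A p

theorem applyOver_complex (A : Hypermatrix V m) (x : V → ℂ) (i : V) :
    A.applyOver x i = A.apply x i := by
  simp only [applyOver, apply, Complex.real_smul]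

theorem applyOver_algebraMap (A : Hypermatrix V m) (x : V → ℝ) (i : V) :
    A.applyOver (fun j => algebraMap ℝ R (x j)) i = algebraMap ℝ R (A.applyOver x i) := by
  simp only [applyOver, map_sum, ← map_prod, Algebra.smul_def, map_mul, Algebra.algebraMap_self,
    RingHom.id_apply]

theorem applyOver_one (A : Hypermatrix V m) (i : V) :
    A.applyOver (1 : V → R) i = algebraMap ℝ R (A.rowSum i) := by
  simp only [applyOver, rowSum, Pi.one_apply, prod_const_one, map_sum,
    Algebra.algebraMap_eq_smul_one]

theorem applyOver_add (A B : Hypermatrix V m) (x : V → R) (i : V) :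
    (A + B).applyOver x i = A.applyOver x i + B.applyOver x i := by
  simp only [applyOver, Pi.add_apply, add_smul, sum_add_distrib]

theorem applyOver_smul (A : Hypermatrix V m) (r : ℝ) (x : V → R) (i : V) :
    A.applyOver (r • x) i = r ^ (m - 1) • A.applyOver x i := by
  simp only [applyOver, smul_sum, Pi.smul_apply, prod_smul, prod_const, card_filter_val_ne_zero,
    smul_comm (r ^ (m - 1))]

theorem applyOver_single (A : Hypermatrix V m) (i j : V) :
    A.applyOver (Pi.single i (1 : R)) j = algebraMap ℝ R (A (consConst m j i)) := by
  rw [applyOver, sum_eq_single (consConst m j i), prod_consConst, Pi.single_eq_same, one_pow,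
    Algebra.algebraMap_eq_smul_one]
  · intro p hp hne
    obtain ⟨l, hl⟩ := Function.ne_iff.1 hne
    have hl0 : l.val ≠ 0 := fun h => hl (by simp [consConst, h, (mem_filter.1 hp).2 l h])
    rw [prod_eq_zero (mem_filter.2 ⟨mem_univ l, hl0⟩), smul_zero]
    exact Pi.single_eq_of_ne (by simpa [consConst, hl0] using hl) _
  · simp +contextual [consConst]

theorem rowSum_eq_of_val_eq_zero (A : Hypermatrix V m) {z : Fin m} (hz : z.val = 0) (i : V) :
    A.rowSum i = ∑ p : Fin m → V with p z = i, A p := by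
  simp only [rowSum, forall_val_eq_zero_imp_iff hz]

theorem mem_eigenvalueSet_of_rowSum_eq [Nonempty V] [Nontrivial R] {A : Hypermatrix V m} {c : ℝ}
    (h : ∀ i, A.rowSum i = c) : algebraMap ℝ R c ∈ A.eigenvalueSet R :=
  ⟨1, one_ne_zero, fun i => by rw [applyOver_one, h, Pi.one_apply, one_pow, mul_one]⟩

theorem isEigenpair_iff {A : Hypermatrix V m} {c : ℂ} {x : V → ℂ} :
    A.IsEigenpair c x ↔ x ≠ 0 ∧ ∀ i, A.applyOver x i = c * x i ^ (m - 1) := by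
  simp only [IsEigenpair, applyOver_complex]

theorem isEigenvalue_iff_mem_eigenvalueSet {A : Hypermatrix V m} {c : ℂ} :
    A.IsEigenvalue c ↔ c ∈ A.eigenvalueSet ℂ :=
  exists_congr fun _ => isEigenpair_iff

theorem isHEigenvalue_iff_mem_eigenvalueSet {A : Hypermatrix V m} {c : ℝ} :
    A.IsHEigenvalue c ↔ c ∈ A.eigenvalueSet ℝ := by
  refine exists_congr fun x => isEigenpair_iff.trans (and_congr (not_congr ?_) ?_)
  · simp only [funext_iff, Pi.zero_apply, Complex.ofReal_eq_zero]
  · exact forall_congr' fun i => by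
      rw [← Complex.coe_algebraMap, applyOver_algebraMap, Complex.coe_algebraMap]
      norm_cast

theorem IsHEigenvalue.isEigenvalue {A : Hypermatrix V m} {c : ℝ} (h : A.IsHEigenvalue c) :
    A.IsEigenvalue (c : ℂ) :=
  let ⟨_, hx⟩ := h
  ⟨_, hx⟩

end Algebra

section Order

variable {A B : Hypermatrix V m}

theorem applyOver_nonneg (hA : 0 ≤ A) {x : V → ℝ} (hx : 0 ≤ x) (i : V) : 0 ≤ A.applyOver x i :=
  sum_nonneg fun p _ => smul_nonneg (hA p) (prod_nonneg fun _ _ => hx _)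

theorem rowSum_nonneg (hA : 0 ≤ A) : 0 ≤ A.rowSum :=
  fun _ => sum_nonneg fun p _ => hA p

theorem applyOver_mono_left (hAB : A ≤ B) {x : V → ℝ} (hx : 0 ≤ x) (i : V) :
    A.applyOver x i ≤ B.applyOver x i :=
  sum_le_sum fun p _ => smul_le_smul_of_nonneg_right (hAB p) (prod_nonneg fun _ _ => hx _)

theorem applyOver_lt_applyOver (hA : ∀ p, 0 < A p) (hm : 2 ≤ m) {x y : V → ℝ} (hx : 0 ≤ x)
    (hxy : x < y) (i : V) : A.applyOver x i < A.applyOver y i := by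
  obtain ⟨hle, k, hk⟩ := Pi.lt_def.1 hxy
  refine sum_lt_sum (fun p _ => smul_le_smul_of_nonneg_left
    (prod_le_prod (fun _ _ => hx _) fun _ _ => hle _) (hA p).le) ⟨consConst m i k, ?_, ?_⟩
  · simp +contextual [consConst]
  · rw [prod_consConst, prod_consConst]
    exact smul_lt_smul_of_pos_left (pow_lt_pow_left₀ hk (hx k) (by lia)) (hA _)

theorem applyOver_pos (hA : ∀ p, 0 < A p) (hm : 2 ≤ m) {x : V → ℝ} (hx : 0 < x) (i : V) :
    0 < A.applyOver x i :=
  (applyOver_nonneg (fun p => (hA p).le) le_rfl i).trans_lt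
    (applyOver_lt_applyOver hA hm le_rfl hx i)

end Order

section Spectrum

variable {𝕜 : Type*} [NormedField 𝕜] [NormedAlgebra ℝ 𝕜]

theorem continuous_applyOver (i : V) :
    Continuous fun q : Hypermatrix V m × (V → 𝕜) => q.1.applyOver q.2 i := by
  unfold applyOver
  fun_prop

theorem norm_applyOver_le (A : Hypermatrix V m) {x : V → 𝕜} (hx : ‖x‖ ≤ 1) (i : V) :
    ‖A.applyOver x i‖ ≤ rowSum |A| i := by
  refine (norm_sum_le _ _).trans (sum_le_sum fun p _ => ?_)
  rw [norm_smul, Real.norm_eq_abs, norm_prod]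
  exact mul_le_of_le_one_right (abs_nonneg _)
    (prod_le_one (fun _ _ => norm_nonneg _) fun _ _ => (norm_le_pi_norm x _).trans hx)

theorem rowSum_abs_le_sum_abs (A : Hypermatrix V m) (i : V) : rowSum |A| i ≤ ∑ p, |A p| :=
  sum_le_univ_sum_of_nonneg fun _ => abs_nonneg _

theorem mem_eigenvalueSet_iff_norm_eq_one {A : Hypermatrix V m} {c : 𝕜} :
    c ∈ A.eigenvalueSet 𝕜 ↔
      ∃ x : V → 𝕜, ‖x‖ = 1 ∧ ∀ i, A.applyOver x i = c * x i ^ (m - 1) := by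
  constructor
  · rintro ⟨x, hx, h⟩
    refine ⟨‖x‖⁻¹ • x, ?_, fun i => ?_⟩
    · rw [norm_smul, norm_inv, norm_norm, inv_mul_cancel₀ (norm_ne_zero_iff.2 hx)]
    · rw [applyOver_smul, h, Pi.smul_apply, smul_pow, mul_smul_comm]
  · rintro ⟨x, hx, h⟩
    exact ⟨x, norm_ne_zero_iff.1 (hx ▸ one_ne_zero), h⟩

theorem norm_le_sum_abs_of_mem_eigenvalueSet {A : Hypermatrix V m} {c : 𝕜}
    (hc : c ∈ A.eigenvalueSet 𝕜) : ‖c‖ ≤ ∑ p, |A p| := by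
  obtain ⟨x, hx, h⟩ := mem_eigenvalueSet_iff_norm_eq_one.1 hc
  obtain ⟨i, hi⟩ := exists_norm_apply_eq_one hx
  calc ‖c‖ = ‖A.applyOver x i‖ := by rw [h, norm_mul, norm_pow, hi, one_pow, mul_one]
    _ ≤ rowSum |A| i := A.norm_applyOver_le hx.le i
    _ ≤ ∑ p, |A p| := A.rowSum_abs_le_sum_abs i

variable (V m 𝕜) in
theorem isClosed_setOf_mem_eigenvalueSet [ProperSpace 𝕜] :
    IsClosed {q : Hypermatrix V m × 𝕜 | q.2 ∈ q.1.eigenvalueSet 𝕜} := by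
  have hC : IsClosed {q : (V → 𝕜) × Hypermatrix V m × 𝕜 |
      ∀ i, q.2.1.applyOver q.1 i = q.2.2 * q.1 i ^ (m - 1)} := by
    simp only [Set.ofPred_forall]
    refine isClosed_iInter fun i => isClosed_eq ?_ (by fun_prop)
    exact (continuous_applyOver i).comp
      ((continuous_fst.comp continuous_snd).prodMk continuous_fst)
  convert isClosed_setOf_exists_mem_of_isCompact (isCompact_sphere (0 : V → 𝕜) 1) hC
  rw [mem_eigenvalueSet_iff_norm_eq_one]
  simp only [mem_sphere_zero_iff_norm, Set.mem_ofPred_eq]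

theorem isCompact_eigenvalueSet [ProperSpace 𝕜] (A : Hypermatrix V m) :
    IsCompact (A.eigenvalueSet 𝕜) := by
  have hclosed : IsClosed (A.eigenvalueSet 𝕜) :=
    (isClosed_setOf_mem_eigenvalueSet V m 𝕜).preimage (Continuous.prodMk_right A)
  refine (isCompact_closedBall (0 : 𝕜) (∑ p, |A p|)).of_isClosed_subset hclosed fun c hc => ?_
  exact mem_closedBall_zero_iff.2 (norm_le_sum_abs_of_mem_eigenvalueSet hc)

end Spectrum

section CollatzWielandt

variable {A B : Hypermatrix V m}

/-- The real numbers `c` with `c x^{[m-1]} ≤ A x` for some nonnegative `x ≠ 0`. The supremum of this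
set is the Collatz–Wielandt value of `A`. -/
def subeigenvalueSet (A : Hypermatrix V m) : Set ℝ :=
  {c | ∃ x : V → ℝ, 0 < x ∧ ∀ i, c * x i ^ (m - 1) ≤ A.applyOver x i}

theorem subeigenvalueSet_mono (hAB : A ≤ B) : A.subeigenvalueSet ⊆ B.subeigenvalueSet :=
  fun _ ⟨x, hx, h⟩ => ⟨x, hx, fun i => (h i).trans (applyOver_mono_left hAB hx.le i)⟩

theorem mem_subeigenvalueSet_of_le_rowSum [Nonempty V] {c : ℝ} (h : ∀ i, c ≤ A.rowSum i) :
    c ∈ A.subeigenvalueSet :=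
  ⟨1, zero_lt_one, fun i => by
    simpa only [applyOver_one, Algebra.algebraMap_self, RingHom.id_apply, Pi.one_apply, one_pow,
      mul_one] using h i⟩

theorem apply_const_mem_subeigenvalueSet (hA : 0 ≤ A) (hm : 2 ≤ m) (i : V) :
    A (fun _ => i) ∈ A.subeigenvalueSet := by
  refine ⟨Pi.single i 1, Pi.single_pos.2 one_pos, fun j => ?_⟩
  rw [applyOver_single, Algebra.algebraMap_self, RingHom.id_apply]
  rcases eq_or_ne j i with rfl | hj
  · rw [Pi.single_eq_same, one_pow, mul_one, consConst_self]
  · rw [Pi.single_eq_of_ne hj, zero_pow (by lia), mul_zero]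
    exact hA _

theorem zero_mem_subeigenvalueSet [Nonempty V] (hA : 0 ≤ A) : 0 ∈ A.subeigenvalueSet :=
  mem_subeigenvalueSet_of_le_rowSum (rowSum_nonneg hA)

theorem mem_subeigenvalueSet_iff_norm_eq_one {c : ℝ} :
    c ∈ A.subeigenvalueSet ↔
      ∃ x : V → ℝ, ‖x‖ = 1 ∧ 0 ≤ x ∧ ∀ i, c * x i ^ (m - 1) ≤ A.applyOver x i := by
  constructor
  · rintro ⟨x, hx, h⟩
    have hnorm : 0 < ‖x‖⁻¹ := inv_pos.2 (norm_pos_iff.2 hx.ne')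
    refine ⟨‖x‖⁻¹ • x, ?_, smul_nonneg hnorm.le hx.le, fun i => ?_⟩
    · rw [norm_smul, norm_inv, norm_norm, inv_mul_cancel₀ (norm_ne_zero_iff.2 hx.ne')]
    · rw [applyOver_smul, Pi.smul_apply, smul_pow, mul_smul_comm]
      exact smul_le_smul_of_nonneg_left (h i) (by positivity)
  · rintro ⟨x, hx1, hx, h⟩
    exact ⟨x, hx.lt_of_ne' (norm_ne_zero_iff.1 (hx1 ▸ one_ne_zero)), h⟩

theorem bddAbove_subeigenvalueSet (A : Hypermatrix V m) : BddAbove A.subeigenvalueSet := by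
  refine ⟨∑ p, |A p|, fun c hc => ?_⟩
  obtain ⟨x, hx1, hx, h⟩ := mem_subeigenvalueSet_iff_norm_eq_one.1 hc
  obtain ⟨i, hi⟩ := exists_norm_apply_eq_one hx1
  rw [Real.norm_of_nonneg (hx i)] at hi
  calc c = c * x i ^ (m - 1) := by rw [hi, one_pow, mul_one]
    _ ≤ ‖A.applyOver x i‖ := (h i).trans (Real.le_norm_self _)
    _ ≤ rowSum |A| i := A.norm_applyOver_le hx1.le i
    _ ≤ ∑ p, |A p| := A.rowSum_abs_le_sum_abs i

theorem isClosed_subeigenvalueSet (A : Hypermatrix V m) : IsClosed A.subeigenvalueSet := by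
  have hC : IsClosed {q : (V → ℝ) × ℝ |
      0 ≤ q.1 ∧ ∀ i, q.2 * q.1 i ^ (m - 1) ≤ A.applyOver q.1 i} := by
    simp only [Set.ofPred_and, Set.ofPred_forall]
    refine (isClosed_le continuous_const continuous_fst).inter
      (isClosed_iInter fun i => isClosed_le (by fun_prop) ?_)
    exact (continuous_applyOver i).comp (continuous_const.prodMk continuous_fst)
  convert isClosed_setOf_exists_mem_of_isCompact (isCompact_sphere (0 : V → ℝ) 1) hC
  ext c
  rw [mem_subeigenvalueSet_iff_norm_eq_one]
  simp only [mem_sphere_zero_iff_norm, Set.mem_ofPred_eq]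

theorem isGreatest_sSup_subeigenvalueSet (h : A.subeigenvalueSet.Nonempty) :
    IsGreatest A.subeigenvalueSet (sSup A.subeigenvalueSet) :=
  A.isClosed_subeigenvalueSet.isGreatest_csSup h A.bddAbove_subeigenvalueSet

theorem exists_gt_mem_subeigenvalueSet [Nonempty V] {y : V → ℝ} (hy : ∀ i, 0 < y i) {c : ℝ}
    (h : ∀ i, c * y i ^ (m - 1) < A.applyOver y i) : ∃ c' > c, c' ∈ A.subeigenvalueSet := by
  obtain ⟨k, hk⟩ := Finite.exists_min fun i => A.applyOver y i / y i ^ (m - 1)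
  refine ⟨A.applyOver y k / y k ^ (m - 1), (lt_div_iff₀ (pow_pos (hy k) _)).2 (h k), y,
    Pi.lt_def.2 ⟨fun i => (hy i).le, k, hy k⟩, fun i => ?_⟩
  exact (le_div_iff₀ (pow_pos (hy i) _)).1 (hk i)

/-- The vector `y` with `y^{[m-1]} = A x` dominates `c^{1/(m-1)} x`, strictly somewhere unless `x`
is an eigenvector; as `A` is positive, then `A y > c A x = c y^{[m-1]}` in every coordinate. -/
theorem exists_gt_mem_subeigenvalueSet_of_ne (hA : ∀ p, 0 < A p) (hm : 2 ≤ m) {x : V → ℝ}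
    (hx : 0 < x) {c : ℝ} (hc : 0 ≤ c) (h : ∀ i, c * x i ^ (m - 1) ≤ A.applyOver x i)
    (hne : ∃ k, A.applyOver x k ≠ c * x k ^ (m - 1)) : ∃ c' > c, c' ∈ A.subeigenvalueSet := by
  have hm' : m - 1 ≠ 0 := by lia
  have exists_root : ∀ a : ℝ, 0 ≤ a → ∃ b, 0 ≤ b ∧ b ^ (m - 1) = a := fun a ha =>
    ⟨a ^ (((m - 1 : ℕ) : ℝ)⁻¹), by positivity, Real.rpow_inv_natCast_pow ha hm'⟩
  have hAx : ∀ i, 0 < A.applyOver x i := applyOver_pos hA hm hx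
  obtain ⟨s, hs0, hs⟩ := exists_root c hc
  choose y hy0 hy using fun i => exists_root (A.applyOver x i) (hAx i).le
  have hypos : ∀ i, 0 < y i := fun i =>
    (hy0 i).lt_of_ne' fun h0 => (hAx i).ne' (by rw [← hy, h0, zero_pow hm'])
  have hle : s • x ≤ y := fun i => le_of_pow_le_pow_left₀ hm' (hy0 i) <| by
    rw [Pi.smul_apply, smul_pow, hs, hy]
    exact h i
  have hlt : s • x < y := hle.lt_of_ne fun heq => hne.elim fun k hk => hk <| by
    rw [← hy, ← heq, Pi.smul_apply, smul_pow, hs, smul_eq_mul]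
  obtain ⟨k, -⟩ := hne
  have : Nonempty V := ⟨k⟩
  refine exists_gt_mem_subeigenvalueSet hypos fun i => ?_
  calc c * y i ^ (m - 1) = A.applyOver (s • x) i := by rw [applyOver_smul, hs, hy, smul_eq_mul]
    _ < A.applyOver y i := applyOver_lt_applyOver hA hm (smul_nonneg hs0 hx.le) hlt i

theorem mem_eigenvalueSet_of_isGreatest [Nonempty V] (hA : ∀ p, 0 < A p) (hm : 2 ≤ m) {r : ℝ}
    (hr : IsGreatest A.subeigenvalueSet r) : r ∈ A.eigenvalueSet ℝ := by
  have hr0 : 0 ≤ r := hr.2 (zero_mem_subeigenvalueSet fun p => (hA p).le)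
  obtain ⟨x, hx, h⟩ := hr.1
  refine ⟨x, hx.ne', by_contra fun hne => ?_⟩
  obtain ⟨c, hc, hmem⟩ :=
    exists_gt_mem_subeigenvalueSet_of_ne hA hm hx hr0 h (not_forall.1 hne)
  exact (hr.2 hmem).not_gt hc

/-- Perturb `A` to the positive hypermatrices `A + 1/(n+1)`: their Collatz–Wielandt values decrease
to a limit, which is an eigenvalue of `A` because the graph of `eigenvalueSet` is closed. -/
theorem exists_ge_mem_eigenvalueSet [Nonempty V] (hA : 0 ≤ A) (hm : 2 ≤ m) {c : ℝ}
    (hc : c ∈ A.subeigenvalueSet) : ∃ c' ≥ c, c' ∈ A.eigenvalueSet ℝ := by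
  let P : ℕ → Hypermatrix V m := fun n p => A p + 1 / ((n : ℝ) + 1)
  let r : ℕ → ℝ := fun n => sSup (P n).subeigenvalueSet
  have hPpos : ∀ n p, 0 < P n p := fun n p => add_pos_of_nonneg_of_pos (hA p) (by positivity)
  have hAP : ∀ n, A ≤ P n := fun n p => le_add_of_nonneg_right (by positivity)
  have hPanti : Antitone P := fun k n hkn p =>
    add_le_add_right (Nat.one_div_le_one_div hkn) (A p)
  have hPlim : Tendsto P atTop (𝓝 A) := tendsto_pi_nhds.2 fun p => by
    simpa only [add_zero] using tendsto_one_div_add_atTop_nhds_zero_nat.const_add (A p)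
  have hr : ∀ n, IsGreatest (P n).subeigenvalueSet (r n) := fun n =>
    isGreatest_sSup_subeigenvalueSet ⟨c, subeigenvalueSet_mono (hAP n) hc⟩
  have hcr : ∀ n, c ≤ r n := fun n => (hr n).2 (subeigenvalueSet_mono (hAP n) hc)
  have hranti : Antitone r := fun k n hkn =>
    (hr k).2 (subeigenvalueSet_mono (hPanti hkn) (hr n).1)
  have hrlim : Tendsto r atTop (𝓝 (⨅ n, r n)) :=
    tendsto_atTop_ciInf hranti ⟨c, Set.forall_mem_range.2 hcr⟩
  refine ⟨⨅ n, r n, le_ciInf hcr, ?_⟩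
  exact (isClosed_setOf_mem_eigenvalueSet V m ℝ).mem_of_tendsto (hPlim.prodMk_nhds hrlim)
    (Eventually.of_forall fun n => mem_eigenvalueSet_of_isGreatest (hPpos n) hm (hr n))

theorem isGreatest_spectralRadius [Nonempty V] (hA : 0 ≤ A) (hm : 2 ≤ m) :
    IsGreatest A.eigenvalueModuli A.spectralRadius := by
  have hmoduli : A.eigenvalueModuli = norm '' A.eigenvalueSet ℂ := by
    ext r
    simp only [eigenvalueModuli, isEigenvalue_iff_mem_eigenvalueSet, Set.mem_ofPred_eq,
      Set.mem_image, eq_comm]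
  obtain ⟨c, -, hc⟩ := exists_ge_mem_eigenvalueSet hA hm (zero_mem_subeigenvalueSet hA)
  have hne : A.eigenvalueModuli.Nonempty :=
    ⟨_, c, (isHEigenvalue_iff_mem_eigenvalueSet.2 hc).isEigenvalue, rfl⟩
  rw [spectralRadius]
  rw [hmoduli] at hne ⊢
  exact (A.isCompact_eigenvalueSet.image continuous_norm).isGreatest_sSup hne

theorem le_spectralRadius [Nonempty V] (hA : 0 ≤ A) (hm : 2 ≤ m) {c : ℝ}
    (hc : c ∈ A.subeigenvalueSet) : c ≤ A.spectralRadius := by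
  obtain ⟨c', hcc', hc'⟩ := exists_ge_mem_eigenvalueSet hA hm hc
  calc c ≤ ‖(c' : ℂ)‖ := by
        rw [Complex.norm_real]
        exact hcc'.le.trans (Real.le_norm_self c')
    _ ≤ A.spectralRadius := (isGreatest_spectralRadius hA hm).2
        ⟨c', (isHEigenvalue_iff_mem_eigenvalueSet.2 hc').isEigenvalue, rfl⟩

end CollatzWielandt

section Diagonal

variable {R : Type*} [CommRing R] [Algebra ℝ R] {𝕜 : Type*} [NormedField 𝕜] [NormedAlgebra ℝ 𝕜]

/-- The diagonal hypermatrix of order `m` with diagonal entries `d i`. -/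
def diagonal (m : ℕ) (d : V → ℝ) : Hypermatrix V m := fun p => ∑ i, if ∀ j, p j = i then d i else 0

theorem diagonal_nonneg {d : V → ℝ} (hd : 0 ≤ d) : 0 ≤ diagonal m d :=
  fun p => sum_nonneg fun i _ => by
    split_ifs
    exacts [hd i, le_rfl]

theorem diagonal_const (hm : m ≠ 0) (d : V → ℝ) (i : V) : diagonal m d (fun _ => i) = d i := by
  have : NeZero m := ⟨hm⟩
  simp only [diagonal, forall_const, sum_ite_eq, mem_univ, if_true]

theorem diagonal_eq_zero {d : V → ℝ} {p : Fin m → V} (h : ∀ i, p ≠ fun _ => i) :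
    diagonal m d p = 0 :=
  sum_eq_zero fun i _ => if_neg fun hi => h i (funext hi)

theorem applyOver_diagonal (hm : m ≠ 0) (d : V → ℝ) (x : V → R) (i : V) :
    (diagonal m d).applyOver x i = d i • x i ^ (m - 1) := by
  rw [applyOver, sum_eq_single fun _ => i, diagonal_const hm, prod_const, card_filter_val_ne_zero]
  · intro p hp hne
    rw [diagonal_eq_zero, zero_smul]
    rintro k rfl
    exact hne (funext fun _ => (mem_filter.1 hp).2 ⟨0, by lia⟩ rfl)
  · simp

/-- Gershgorin's disc theorem. -/
theorem exists_norm_sub_le_rowSum_abs (hm : m ≠ 0) {d : V → ℝ} {A : Hypermatrix V m} {c : 𝕜}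
    (hc : c ∈ (diagonal m d + A).eigenvalueSet 𝕜) :
    ∃ i, ‖c - algebraMap ℝ 𝕜 (d i)‖ ≤ rowSum |A| i := by
  obtain ⟨x, hx, h⟩ := mem_eigenvalueSet_iff_norm_eq_one.1 hc
  obtain ⟨i, hi⟩ := exists_norm_apply_eq_one hx
  have hA : A.applyOver x i = (c - algebraMap ℝ 𝕜 (d i)) * x i ^ (m - 1) := by
    rw [sub_mul, ← h, applyOver_add, applyOver_diagonal hm, Algebra.smul_def, add_sub_cancel_left]
  refine ⟨i, ?_⟩
  calc ‖c - algebraMap ℝ 𝕜 (d i)‖ = ‖A.applyOver x i‖ := by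
        rw [hA, norm_mul, norm_pow, hi, one_pow, mul_one]
    _ ≤ rowSum |A| i := A.norm_applyOver_le hx.le i

end Diagonal

section SignlessLaplacian

variable {R : Type*} [CommRing R] [Algebra ℝ R] {𝕜 : Type*} [NormedField 𝕜] [NormedAlgebra ℝ 𝕜]
variable {A : Hypermatrix V m}

/-- The hypermatrix `D + A`, where `D` is diagonal and has the same row sums as `A`. -/
noncomputable def signlessLaplacian (A : Hypermatrix V m) : Hypermatrix V m :=
  diagonal m A.rowSum + A

theorem signlessLaplacian_nonneg (hA : 0 ≤ A) : 0 ≤ A.signlessLaplacian :=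
  add_nonneg (diagonal_nonneg (rowSum_nonneg hA)) hA

theorem applyOver_signlessLaplacian (hm : m ≠ 0) (A : Hypermatrix V m) (x : V → R) (i : V) :
    A.signlessLaplacian.applyOver x i = A.rowSum i • x i ^ (m - 1) + A.applyOver x i := by
  rw [signlessLaplacian, applyOver_add, applyOver_diagonal hm]

theorem rowSum_signlessLaplacian (hm : m ≠ 0) (A : Hypermatrix V m) (i : V) :
    A.signlessLaplacian.rowSum i = 2 * A.rowSum i := by
  have h := A.applyOver_signlessLaplacian hm (1 : V → ℝ) i
  simp only [applyOver_one, Algebra.algebraMap_self, RingHom.id_apply, Pi.one_apply, one_pow,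
    smul_eq_mul, mul_one] at h
  rw [h, two_mul]

theorem exists_norm_sub_rowSum_le (hA : 0 ≤ A) (hm : m ≠ 0) {c : 𝕜}
    (hc : c ∈ A.signlessLaplacian.eigenvalueSet 𝕜) :
    ∃ i, ‖c - algebraMap ℝ 𝕜 (A.rowSum i)‖ ≤ A.rowSum i := by
  simpa only [abs_of_nonneg hA] using exists_norm_sub_le_rowSum_abs hm hc

theorem norm_le_two_mul_of_mem_eigenvalueSet_signlessLaplacian (hA : 0 ≤ A) (hm : m ≠ 0) {r : ℝ}
    (hr : ∀ i, A.rowSum i ≤ r) {c : 𝕜} (hc : c ∈ A.signlessLaplacian.eigenvalueSet 𝕜) :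
    ‖c‖ ≤ 2 * r := by
  obtain ⟨i, hi⟩ := exists_norm_sub_rowSum_le hA hm hc
  calc ‖c‖ ≤ ‖c - algebraMap ℝ 𝕜 (A.rowSum i)‖ + ‖algebraMap ℝ 𝕜 (A.rowSum i)‖ :=
        norm_le_norm_sub_add _ _
    _ ≤ r + r := by
        rw [norm_algebraMap', Real.norm_of_nonneg (rowSum_nonneg hA i)]
        exact add_le_add (hi.trans (hr i)) (hr i)
    _ = 2 * r := (two_mul r).symm

theorem nonneg_of_mem_eigenvalueSet_signlessLaplacian (hA : 0 ≤ A) (hm : m ≠ 0) {c : ℝ}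
    (hc : algebraMap ℝ 𝕜 c ∈ A.signlessLaplacian.eigenvalueSet 𝕜) : 0 ≤ c := by
  obtain ⟨i, hi⟩ := exists_norm_sub_rowSum_le hA hm hc
  rw [← map_sub, norm_algebraMap', Real.norm_eq_abs] at hi
  linarith [neg_le_of_abs_le hi]

theorem exists_ge_rowSum_mem_eigenvalueSet_signlessLaplacian (hA : 0 ≤ A) (hm : 2 ≤ m) (i : V) :
    ∃ c ≥ A.rowSum i, c ∈ A.signlessLaplacian.eigenvalueSet ℝ := by
  have : Nonempty V := ⟨i⟩
  obtain ⟨c, hc, hmem⟩ := exists_ge_mem_eigenvalueSet (signlessLaplacian_nonneg hA) hm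
    (apply_const_mem_subeigenvalueSet (signlessLaplacian_nonneg hA) hm i)
  refine ⟨c, le_trans ?_ hc, hmem⟩
  rw [signlessLaplacian, Pi.add_apply, diagonal_const (by lia)]
  exact le_add_of_nonneg_right (hA _)

theorem applyOver_signlessLaplacian_single (hm : 2 ≤ m) {i : V}
    (h : ∀ j, A (consConst m j i) = 0) (j : V) :
    A.signlessLaplacian.applyOver (Pi.single i (1 : R)) j =
      algebraMap ℝ R (A.rowSum i) * (Pi.single i (1 : R) : V → R) j ^ (m - 1) := by
  rw [applyOver_signlessLaplacian (by lia), applyOver_single, h, map_zero, add_zero,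
    Algebra.smul_def]
  rcases eq_or_ne j i with rfl | hj
  · rfl
  · rw [Pi.single_eq_of_ne hj, zero_pow (by lia), mul_zero, mul_zero]

/-- If the signs multiply to `-1` along every nonzero entry, then `A x = -D x^{[m-1]}`. -/
theorem zero_mem_eigenvalueSet_signlessLaplacian [Nonempty V] [Nontrivial R] (hm0 : m ≠ 0)
    (hm : Even m) {x : V → R} (hx : ∀ i, x i ^ 2 = 1)
    (h : ∀ p, A p ≠ 0 → ∏ j, x (p j) = -1) : 0 ∈ A.signlessLaplacian.eigenvalueSet R := by
  have hx0 : x ≠ 0 := by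
    rintro rfl
    simpa using hx (Classical.arbitrary V)
  have hpow : ∀ i, x i ^ (m - 1) = x i := fun i => by
    obtain ⟨k, hk⟩ := Nat.Even.sub_odd (Nat.one_le_iff_ne_zero.2 hm0) hm odd_one
    rw [hk, pow_succ, pow_mul, hx, one_pow, one_mul]
  have hA : ∀ i, A.applyOver x i = -(A.rowSum i • x i) := fun i => by
    rw [applyOver, rowSum, sum_smul, ← sum_neg_distrib]
    refine sum_congr rfl fun p hp => ?_
    by_cases hAp : A p = 0
    · simp only [hAp, zero_smul, neg_zero]
    have hpi : p ⟨0, by lia⟩ = i := (mem_filter.1 hp).2 _ rfl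
    have hprod := mul_prod_filter_val_ne_zero (z := ⟨0, by lia⟩) rfl fun j => x (p j)
    rw [h p hAp, hpi] at hprod
    rw [← smul_neg]
    congr 1
    linear_combination x i * hprod - (∏ j : Fin m with j.val ≠ 0, x (p j)) * hx i
  refine ⟨x, hx0, fun i => ?_⟩
  rw [applyOver_signlessLaplacian hm0, hpow, hA, zero_mul, add_neg_cancel]

end SignlessLaplacian

end Hypermatrix

theorem sum_pow_card_eq_sum_prod_pow_card_fiber {ι κ R : Type*} [Fintype ι] [DecidableEq ι]
    [Fintype κ] [DecidableEq κ] [CommSemiring R] (x : κ → R) :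
    (∑ c, x c) ^ Fintype.card ι = ∑ f : ι → κ, ∏ c, x c ^ #{j | f j = c} := by
  simp only [← prod_const, prod_fiberwise']
  rw [← card_univ, ← prod_const, prod_univ_sum, Fintype.piFinset_univ]

/-- Compare coefficients in the two expansions of `(∑ c, X c) ^ card ι`. -/
theorem card_filter_card_fiber_eq_multinomial {ι κ : Type*} [Fintype ι] [DecidableEq ι]
    [Fintype κ] [DecidableEq κ] (t : κ → ℕ) (ht : ∑ c, t c = Fintype.card ι) :
    #{f : ι → κ | ∀ c, #{j | f j = c} = t c} = Nat.multinomial univ t := by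
  have hmonomial : ∀ u : κ → ℕ, ∏ c, (MvPolynomial.X c : MvPolynomial κ ℕ) ^ u c =
      MvPolynomial.monomial (Finsupp.equivFunOnFinite.symm u) 1 := fun u => by
    rw [MvPolynomial.monomial_eq, Finsupp.prod_fintype _ _ fun _ => pow_zero _, map_one, one_mul]
    rfl
  have hpow := sum_pow_eq_sum_piAntidiag (univ : Finset κ)
    (fun c => (MvPolynomial.X c : MvPolynomial κ ℕ)) (Fintype.card ι)
  rw [sum_pow_card_eq_sum_prod_pow_card_fiber] at hpow
  have hcoeff := congrArg (MvPolynomial.coeff (Finsupp.equivFunOnFinite.symm t)) hpow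
  simp only [hmonomial, MvPolynomial.coeff_sum, MvPolynomial.coeff_monomial,
    EmbeddingLike.apply_eq_iff_eq, ← map_natCast (MvPolynomial.C : ℕ →+* MvPolynomial κ ℕ),
    MvPolynomial.coeff_C_mul, mul_ite, mul_one, mul_zero, sum_ite_eq', mem_piAntidiag, ht,
    sum_boole, Nat.cast_id, mem_univ, implies_true, and_self, if_true] at hcoeff
  simpa only [funext_iff] using hcoeff

namespace DirectedEdge

theorem card_surjective_eq_positiveMultinomialSum {ι : Type*} [Fintype ι] [DecidableEq ι]
    (k : ℕ) : #{f : ι → Fin k | f.Surjective} = positiveMultinomialSum k (Fintype.card ι) := by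
  have hfiber : ∀ (f : ι → Fin k) (c : Fin k), 1 ≤ #{j | f j = c} ↔ ∃ j, f j = c := fun f c => by
    simp only [Nat.one_le_iff_ne_zero, ne_eq, card_eq_zero, filter_eq_empty_iff, mem_univ,
      true_imp_iff, not_forall, not_not]
  rw [positiveMultinomialSum, card_eq_sum_card_fiberwise (f := fun f c => #{j | f j = c})
    (t := {t ∈ (univ : Finset (Fin k)).piAntidiag (Fintype.card ι) | ∀ i, 1 ≤ t i})]
  · refine sum_congr rfl fun t ht => ?_
    obtain ⟨ht, htpos⟩ := mem_filter.1 ht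
    rw [← card_filter_card_fiber_eq_multinomial t (mem_piAntidiag.1 ht).1, filter_filter]
    congr 1
    ext f
    simp only [mem_filter, mem_univ, true_and, funext_iff, and_iff_right_iff_imp]
    exact fun h c => (hfiber f c).1 ((htpos c).trans_eq (h c).symm)
  · intro f hf
    refine mem_filter.2 ⟨mem_piAntidiag.2 ⟨?_, fun _ _ => mem_univ _⟩, fun c => ?_⟩
    · exact (card_eq_sum_card_fiberwise fun _ _ => mem_univ _).symm
    · exact (hfiber f c).2 ((mem_filter.1 hf).2 c)

theorem card_filter_image_univ_eq {ι V : Type*} [Fintype ι] [DecidableEq ι] [Fintype V]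
    [DecidableEq V] (T : Finset V) :
    #{f : ι → V | univ.image f = T} = positiveMultinomialSum #T (Fintype.card ι) := by
  let φ : Fin #T → V := fun c => T.equivFin.symm c
  have hφ : φ.Injective := Subtype.val_injective.comp T.equivFin.symm.injective
  have hφT : Set.range φ = T := (T.equivFin.symm.surjective.range_comp _).trans Subtype.range_coe
  have himage : ∀ g : ι → Fin #T, univ.image (φ ∘ g) = T ↔ g.Surjective := fun g => by
    rw [← coe_inj, coe_image, coe_univ, Set.image_univ, Set.range_comp, ← hφT,
      ← Set.image_univ (f := φ), hφ.image_injective.eq_iff, Set.range_eq_univ]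
  rw [← card_surjective_eq_positiveMultinomialSum]
  refine (card_nbij (φ ∘ ·) (fun g hg => ?_) hφ.comp_left.injOn fun f hf => ?_).symm
  · exact mem_filter.2 ⟨mem_univ _, (himage g).2 (mem_filter.1 hg).2⟩
  · have hfT := (mem_filter.1 hf).2
    have hrange : Set.range f ⊆ Set.range φ := by
      rw [hφT, ← hfT, coe_image, coe_univ, Set.image_univ]
    obtain ⟨g, rfl⟩ := Set.range_subset_range_iff_exists_comp.1 hrange
    exact ⟨g, mem_filter.2 ⟨mem_univ _, (himage g).1 hfT⟩, rfl⟩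

theorem positiveMultinomialSum_pos {k N : ℕ} (hk : 0 < k) (hN : k ≤ N) :
    0 < positiveMultinomialSum k N := by
  have : NeZero k := ⟨hk.ne'⟩
  rw [← Fintype.card_fin N, ← card_surjective_eq_positiveMultinomialSum]
  exact card_pos.2 ⟨Function.invFun (Fin.castLE hN), mem_filter.2
    ⟨mem_univ _, Function.invFun_surjective (Fin.castLE_injective hN)⟩⟩

theorem alpha_eq_sum_Icc (m s k : ℕ) :
    alpha m s k = ∑ t ∈ Icc k (m - s + k),
      positiveMultinomialSum k t * positiveMultinomialSum (s - k) (m - t) := by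
  have h := sum_Ico_add'
    (fun t => positiveMultinomialSum k t * positiveMultinomialSum (s - k) (m - t)) 0 (m - s + 1) k
  rw [zero_add, add_right_comm] at h
  rw [alpha, ← Ico_add_one_right_eq_Icc, ← h, range_eq_Ico]
  exact sum_congr rfl fun r _ => by rw [Nat.sub_sub, add_comm k r]

variable {V : Type*} [DecidableEq V] {e : DirectedEdge V} {m : ℕ} {p : Fin m → V} {t t' : ℕ}

theorem card_verts (e : DirectedEdge V) : #e.verts = #e.tail + #e.head :=
  card_union_of_disjoint e.disjoint

/-- The first `t` entries of `p` run over the tail of `e`, and the remaining ones over its head. -/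
abbrev SplitsAt (e : DirectedEdge V) (t : ℕ) (p : Fin m → V) : Prop :=
  (univ.filter fun j : Fin m => (j : ℕ) < t).image p = e.tail ∧
    (univ.filter fun j : Fin m => t ≤ (j : ℕ)).image p = e.head

theorem SplitsAt.apply_mem_tail (h : e.SplitsAt t p) {j : Fin m} (hj : j < t) : p j ∈ e.tail :=
  h.1 ▸ mem_image_of_mem p (mem_filter.2 ⟨mem_univ j, hj⟩)

theorem SplitsAt.apply_mem_head (h : e.SplitsAt t p) {j : Fin m} (hj : t ≤ j) : p j ∈ e.head :=
  h.2 ▸ mem_image_of_mem p (mem_filter.2 ⟨mem_univ j, hj⟩)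

theorem SplitsAt.le (h : e.SplitsAt t p) (h' : e.SplitsAt t' p) (ht' : t' ≤ m) : t' ≤ t := by
  by_contra! hlt
  exact disjoint_left.1 e.disjoint (h'.apply_mem_tail (j := ⟨t, hlt.trans_le ht'⟩) hlt)
    (h.apply_mem_head (j := ⟨t, hlt.trans_le ht'⟩) le_rfl)

theorem card_splitsAt [Fintype V] (e : DirectedEdge V) (ht : t ≤ m) :
    #{p : Fin m → V | e.SplitsAt t p} =
      positiveMultinomialSum #e.tail t * positiveMultinomialSum #e.head (m - t) := by
  have hlt : Fintype.card {j : Fin m // (j : ℕ) < t} = t := by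
    rw [Fintype.card_subtype, Fin.card_filter_val_lt, min_eq_right ht]
  have hge : Fintype.card {j : Fin m // ¬ (j : ℕ) < t} = m - t := by
    rw [Fintype.card_subtype_compl, hlt, Fintype.card_fin]
  have htail := card_filter_image_univ_eq (ι := {j : Fin m // (j : ℕ) < t}) e.tail
  have hhead := card_filter_image_univ_eq (ι := {j : Fin m // ¬ (j : ℕ) < t}) e.head
  rw [hlt] at htail
  rw [hge] at hhead
  rw [← htail, ← hhead, ← card_product]
  refine card_equiv (Equiv.piEquivPiSubtypeProd (fun j : Fin m => (j : ℕ) < t) fun _ => V)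
    fun p => ?_
  simp only [mem_filter, mem_univ, true_and, mem_product, Equiv.piEquivPiSubtypeProd_apply]
  refine and_congr (Eq.congr_left ?_) (Eq.congr_left ?_) <;>
  · ext v
    simp

theorem card_fits [Fintype V] (e : DirectedEdge V) (hm : #e.verts ≤ m) :
    #{p : Fin m → V | e.Fits p} = alpha m #e.verts #e.tail := by
  have hverts := e.card_verts
  have hle : ∀ t ∈ Icc #e.tail (m - #e.verts + #e.tail), t ≤ m := fun t ht => by
    have := (mem_Icc.1 ht).2
    lia
  have hbiUnion : ({p : Fin m → V | e.Fits p} : Finset (Fin m → V)) =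
      (Icc #e.tail (m - #e.verts + #e.tail)).biUnion fun t => {p | e.SplitsAt t p} := by
    ext p
    simp only [mem_filter, mem_univ, true_and, mem_biUnion]
    rfl
  rw [hbiUnion, card_biUnion, alpha_eq_sum_Icc, hverts, Nat.add_sub_cancel_left, ← hverts]
  · exact sum_congr rfl fun t ht => e.card_splitsAt (hle t ht)
  · intro t ht t' ht' hne
    refine disjoint_filter.2 fun p _ h h' => hne ?_
    exact (h'.le h (hle t ht)).antisymm (h.le h' (hle t' ht'))

theorem Fits.apply_mem_tail (h : e.Fits p) {z : Fin m} (hz : z.val = 0) : p z ∈ e.tail := by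
  obtain ⟨t, ht, hsplit⟩ := h
  refine SplitsAt.apply_mem_tail hsplit ?_
  rw [hz]
  exact e.tail_nonempty.card_pos.trans_le (mem_Icc.1 ht).1

theorem Fits.comp_swap (h : e.Fits p) {i j : V} (hi : i ∈ e.tail) (hj : j ∈ e.tail) :
    e.Fits (Equiv.swap i j ∘ p) := by
  obtain ⟨t, ht, htail, hhead⟩ := h
  refine ⟨t, ht, ?_, ?_⟩
  · have hmap : e.tail.map (Equiv.swap i j).toEmbedding = e.tail := map_perm fun v hv => by
      rcases Equiv.swap_apply_ne_self_iff.1 hv with ⟨-, rfl | rfl⟩ <;> assumption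
    rw [← image_image, htail]
    exact (map_eq_image _ _).symm.trans hmap
  · rw [← image_image, hhead]
    have hne : ∀ v ∈ e.head, v ≠ i ∧ v ≠ j := fun v hv =>
      ⟨(disjoint_iff_ne.1 e.disjoint i hi v hv).symm, (disjoint_iff_ne.1 e.disjoint j hj v hv).symm⟩
    conv_rhs => rw [← image_id (s := e.head)]
    exact image_congr fun v hv => Equiv.swap_apply_of_ne_of_ne (hne v hv).1 (hne v hv).2

theorem card_fits_apply_eq_le [Fintype V] (e : DirectedEdge V) (z : Fin m) {i j : V}
    (hi : i ∈ e.tail) (hj : j ∈ e.tail) :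
    #{p : Fin m → V | e.Fits p ∧ p z = i} ≤ #{p : Fin m → V | e.Fits p ∧ p z = j} := by
  refine card_le_card_of_injOn (Equiv.swap i j ∘ ·) (fun p hp => ?_)
    (Equiv.swap i j).injective.comp_left.injOn
  obtain ⟨hfits, hpz⟩ := (mem_filter.1 hp).2
  refine mem_filter.2 ⟨mem_univ _, hfits.comp_swap hi hj, ?_⟩
  exact (congrArg _ hpz).trans (Equiv.swap_apply_left i j)

theorem card_tail_mul_card_fits_apply_eq [Fintype V] (e : DirectedEdge V) (hm : #e.verts ≤ m)
    {z : Fin m} (hz : z.val = 0) {i : V} (hi : i ∈ e.tail) :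
    #e.tail * #{p : Fin m → V | e.Fits p ∧ p z = i} = alpha m #e.verts #e.tail := by
  have hfirst : ∀ p ∈ ({p | e.Fits p} : Finset (Fin m → V)), p z ∈ e.tail := fun p hp =>
    (mem_filter.1 hp).2.apply_mem_tail hz
  calc #e.tail * #{p : Fin m → V | e.Fits p ∧ p z = i}
      = ∑ j ∈ e.tail, #{p : Fin m → V | e.Fits p ∧ p z = j} :=
        (sum_const_nat fun j hj => (e.card_fits_apply_eq_le z hj hi).antisymm
          (e.card_fits_apply_eq_le z hi hj)).symm
    _ = #{p : Fin m → V | e.Fits p} := by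
        simp only [card_eq_sum_card_fiberwise hfirst, filter_filter]
    _ = alpha m #e.verts #e.tail := e.card_fits hm

theorem alpha_pos (e : DirectedEdge V) (hm : #e.verts ≤ m) : 0 < alpha m #e.verts #e.tail := by
  have hverts := e.card_verts
  have hhead := e.head_nonempty.card_pos
  refine sum_pos (fun r hr => ?_) nonempty_range_add_one
  rw [mem_range] at hr
  exact Nat.mul_pos (positiveMultinomialSum_pos e.tail_nonempty.card_pos (by lia))
    (positiveMultinomialSum_pos (by lia) (by lia))

theorem sum_fits_apply_eq [Fintype V] (e : DirectedEdge V) (hm : #e.verts ≤ m) {z : Fin m}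
    (hz : z.val = 0) (i : V) :
    (∑ p : Fin m → V with p z = i,
      if e.Fits p then (#e.tail : ℝ) / (alpha m #e.verts #e.tail : ℝ) else 0) =
      if i ∈ e.tail then 1 else 0 := by
  rw [← sum_filter, filter_filter, sum_const, nsmul_eq_mul]
  simp only [and_comm (a := _ = i)]
  split_ifs with hi
  · have hα : (alpha m #e.verts #e.tail : ℝ) ≠ 0 := Nat.cast_ne_zero.2 (e.alpha_pos hm).ne'
    rw [mul_div_assoc', div_eq_one_iff_eq hα, ← e.card_tail_mul_card_fits_apply_eq hm hz hi,
      Nat.cast_mul, mul_comm]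
  · rw [card_eq_zero.2, Nat.cast_zero, zero_mul]
    exact filter_eq_empty_iff.2 fun p _ hp => hi (hp.2 ▸ hp.1.apply_mem_tail hz)

theorem Fits.image_univ (h : e.Fits p) : univ.image p = e.verts := by
  obtain ⟨t, -, htail, hhead⟩ := h
  rw [verts, ← htail, ← hhead, ← image_union, ← filter_or]
  simp only [lt_or_ge, filter_true]

theorem Fits.prod_eq {M : Type*} [CommMonoid M] (h : e.Fits p) (hm : #e.verts = m) (x : V → M) :
    ∏ j, x (p j) = ∏ v ∈ e.verts, x v := by
  have hinj : Set.InjOn p (univ : Finset (Fin m)) :=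
    card_image_iff.1 (by rw [h.image_univ, hm, card_univ, Fintype.card_fin])
  rw [← h.image_univ, prod_image hinj]

theorem Fits.tail_eq_and_head_eq_of_consConst {i j : V}
    (h : e.Fits (Hypermatrix.consConst m j i)) : e.tail = {j} ∧ e.head = {i} := by
  obtain ⟨t, ht, htail, hhead⟩ := h
  have htpos : 0 < t := e.tail_nonempty.card_pos.trans_le (mem_Icc.1 ht).1
  have hhead' : e.head = {i} := e.head_nonempty.subset_singleton_iff.1 <| by
    rw [← hhead, image_subset_iff]
    exact fun l hl => mem_singleton.2 (if_neg (htpos.trans_le (mem_filter.1 hl).2).ne')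
  refine ⟨e.tail_nonempty.subset_singleton_iff.1 fun v hv => ?_, hhead'⟩
  have hvi : v ≠ i := disjoint_iff_ne.1 e.disjoint v hv i (hhead' ▸ mem_singleton_self i)
  obtain ⟨l, -, rfl⟩ := mem_image.1 (htail ▸ hv)
  exact mem_singleton.2 ((ite_eq_or_eq (l.val = 0) j i).resolve_right hvi)

end DirectedEdge

namespace DirectedHypergraph

open Hypermatrix (consConst)

variable {V : Type*} [DecidableEq V] (H : DirectedHypergraph V)

theorem card_verts_le_rank {e : DirectedEdge V} (he : e ∈ H.edges) : #e.verts ≤ H.rank :=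
  le_sup (f := fun e => #e.verts) he

theorem two_le_rank (hE : H.edges.Nonempty) : 2 ≤ H.rank := by
  obtain ⟨e, he⟩ := hE
  have hverts := e.card_verts
  have htail := e.tail_nonempty.card_pos
  have hhead := e.head_nonempty.card_pos
  have hrank := H.card_verts_le_rank he
  lia

theorem rank_ne_zero (hE : H.edges.Nonempty) : H.rank ≠ 0 :=
  (two_pos.trans_le (H.two_le_rank hE)).ne'

variable {H} in
theorem IsUniform.eq_rank {m : ℕ} (h : H.IsUniform m) (hE : H.edges.Nonempty) : m = H.rank := by
  rw [rank, sup_congr rfl h, sup_const hE]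

theorem outAdjacency_nonneg (m : ℕ) : 0 ≤ H.outAdjacency m :=
  fun p => sum_nonneg fun e _ => by split_ifs <;> positivity

theorem exists_fits_of_outAdjacency_ne_zero {m : ℕ} {p : Fin m → V} (h : H.outAdjacency m p ≠ 0) :
    ∃ e ∈ H.edges, e.Fits p := by
  obtain ⟨e, he, hne⟩ := exists_ne_zero_of_sum_ne_zero h
  exact ⟨e, he, (ite_ne_right_iff.1 hne).1⟩

theorem outAdjacency_consConst_eq_zero {i : V} (hi : H.NotTwoVertexHead i) (m : ℕ) (j : V) :
    H.outAdjacency m (consConst m j i) = 0 := by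
  by_contra hne
  obtain ⟨e, he, hfits⟩ := H.exists_fits_of_outAdjacency_ne_zero hne
  obtain ⟨htail, hhead⟩ := hfits.tail_eq_and_head_eq_of_consConst
  exact hi e he (by rw [e.card_verts, htail, hhead, card_singleton, card_singleton]) hhead

theorem prod_ite_neg_one_eq_neg_one {R : Type*} [CommRing R] {m : ℕ} (hH : H.IsUniform m)
    {S : Finset V} (hS : ∀ e ∈ H.edges, Odd #(e.verts ∩ S)) {p : Fin m → V}
    (hp : H.outAdjacency m p ≠ 0) : ∏ j, (if p j ∈ S then (-1 : R) else 1) = -1 := by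
  obtain ⟨e, he, hfits⟩ := H.exists_fits_of_outAdjacency_ne_zero hp
  rw [hfits.prod_eq (hH e he) fun v => if v ∈ S then (-1 : R) else 1, prod_ite_mem, prod_const,
    (hS e he).neg_one_pow]

section Degree

variable [Fintype V] [Nonempty V]

theorem minOutDegree_le_outDegree (i : V) : H.minOutDegree ≤ H.outDegree i :=
  inf'_le H.outDegree (mem_univ i)

theorem outDegree_le_maxOutDegree (i : V) : H.outDegree i ≤ H.maxOutDegree :=
  le_sup' H.outDegree (mem_univ i)

theorem exists_outDegree_eq_maxOutDegree : ∃ i, H.outDegree i = H.maxOutDegree :=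
  let ⟨i, _, hi⟩ := exists_mem_eq_sup' univ_nonempty H.outDegree
  ⟨i, hi.symm⟩

theorem minOutDegree_le_maxOutDegree : H.minOutDegree ≤ H.maxOutDegree :=
  let ⟨i, hi⟩ := H.exists_outDegree_eq_maxOutDegree
  hi ▸ H.minOutDegree_le_outDegree i

end Degree

section SignlessLaplacian

variable [Fintype V]

theorem rowSum_outAdjacency (hE : H.edges.Nonempty) (i : V) :
    (H.outAdjacency H.rank).rowSum i = H.outDegree i := by
  have hz : ((⟨0, Nat.pos_of_ne_zero (H.rank_ne_zero hE)⟩ : Fin H.rank) : ℕ) = 0 := rfl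
  simp only [Hypermatrix.rowSum_eq_of_val_eq_zero _ hz, outAdjacency]
  rw [sum_comm, sum_congr rfl fun e he => e.sum_fits_apply_eq (H.card_verts_le_rank he) hz i,
    sum_boole, outDegree]

theorem outSignlessLaplacian_eq_signlessLaplacian (hE : H.edges.Nonempty) :
    H.outSignlessLaplacian = (H.outAdjacency H.rank).signlessLaplacian := by
  rw [Hypermatrix.signlessLaplacian, funext (H.rowSum_outAdjacency hE)]
  rfl

theorem outSignlessLaplacian_nonneg (hE : H.edges.Nonempty) : 0 ≤ H.outSignlessLaplacian := by
  rw [H.outSignlessLaplacian_eq_signlessLaplacian hE]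
  exact Hypermatrix.signlessLaplacian_nonneg (H.outAdjacency_nonneg _)

theorem rowSum_outSignlessLaplacian (hE : H.edges.Nonempty) (i : V) :
    H.outSignlessLaplacian.rowSum i = 2 * H.outDegree i := by
  rw [H.outSignlessLaplacian_eq_signlessLaplacian hE,
    Hypermatrix.rowSum_signlessLaplacian (H.rank_ne_zero hE), H.rowSum_outAdjacency hE]

theorem applyOver_outSignlessLaplacian_single {R : Type*} [CommRing R] [Algebra ℝ R]
    (hE : H.edges.Nonempty) {i : V} (hi : H.NotTwoVertexHead i) (j : V) :
    H.outSignlessLaplacian.applyOver (Pi.single i (1 : R)) j =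
      (H.outDegree i : R) * (Pi.single i (1 : R) : V → R) j ^ (H.rank - 1) := by
  rw [H.outSignlessLaplacian_eq_signlessLaplacian hE,
    Hypermatrix.applyOver_signlessLaplacian_single (H.two_le_rank hE)
      (H.outAdjacency_consConst_eq_zero hi _), H.rowSum_outAdjacency hE, map_natCast]

theorem isEigenpair_outDegree_single (hE : H.edges.Nonempty) {i : V} (hi : H.NotTwoVertexHead i) :
    H.outSignlessLaplacian.IsEigenpair (H.outDegree i : ℂ) (Pi.single i 1) :=
  Hypermatrix.isEigenpair_iff.2
    ⟨Pi.single_ne_zero_iff.2 one_ne_zero, H.applyOver_outSignlessLaplacian_single hE hi⟩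

theorem outDegree_mem_eigenvalueSet (hE : H.edges.Nonempty) {i : V} (hi : H.NotTwoVertexHead i) :
    (H.outDegree i : ℝ) ∈ H.outSignlessLaplacian.eigenvalueSet ℝ :=
  ⟨_, Pi.single_ne_zero_iff.2 one_ne_zero, H.applyOver_outSignlessLaplacian_single hE hi⟩

theorem exists_ge_outDegree_mem_eigenvalueSet (hE : H.edges.Nonempty) (i : V) :
    ∃ c ≥ (H.outDegree i : ℝ), c ∈ H.outSignlessLaplacian.eigenvalueSet ℝ := by
  rw [H.outSignlessLaplacian_eq_signlessLaplacian hE, ← H.rowSum_outAdjacency hE]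
  exact Hypermatrix.exists_ge_rowSum_mem_eigenvalueSet_signlessLaplacian
    (H.outAdjacency_nonneg _) (H.two_le_rank hE) i

theorem nonneg_of_mem_eigenvalueSet (hE : H.edges.Nonempty) {c : ℝ}
    (hc : (c : ℂ) ∈ H.outSignlessLaplacian.eigenvalueSet ℂ) : 0 ≤ c := by
  rw [H.outSignlessLaplacian_eq_signlessLaplacian hE] at hc
  exact Hypermatrix.nonneg_of_mem_eigenvalueSet_signlessLaplacian (H.outAdjacency_nonneg _)
    (H.rank_ne_zero hE) hc

variable [Nonempty V]

theorem norm_le_two_mul_maxOutDegree (hE : H.edges.Nonempty) {c : ℂ}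
    (hc : c ∈ H.outSignlessLaplacian.eigenvalueSet ℂ) : ‖c‖ ≤ 2 * H.maxOutDegree := by
  rw [H.outSignlessLaplacian_eq_signlessLaplacian hE] at hc
  refine Hypermatrix.norm_le_two_mul_of_mem_eigenvalueSet_signlessLaplacian
    (H.outAdjacency_nonneg _) (H.rank_ne_zero hE) (fun i => ?_) hc
  rw [H.rowSum_outAdjacency hE]
  exact Nat.cast_le.2 (H.outDegree_le_maxOutDegree i)

theorem isGreatest_spectralRadius (hE : H.edges.Nonempty) :
    IsGreatest H.outSignlessLaplacian.eigenvalueModuli H.outSignlessLaplacian.spectralRadius :=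
  Hypermatrix.isGreatest_spectralRadius (H.outSignlessLaplacian_nonneg hE) (H.two_le_rank hE)

theorem two_mul_minOutDegree_le_spectralRadius (hE : H.edges.Nonempty) :
    2 * (H.minOutDegree : ℝ) ≤ H.outSignlessLaplacian.spectralRadius := by
  refine Hypermatrix.le_spectralRadius (H.outSignlessLaplacian_nonneg hE) (H.two_le_rank hE)
    (Hypermatrix.mem_subeigenvalueSet_of_le_rowSum fun i => ?_)
  rw [H.rowSum_outSignlessLaplacian hE]
  exact_mod_cast Nat.mul_le_mul_left 2 (H.minOutDegree_le_outDegree i)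

theorem spectralRadius_le_two_mul_maxOutDegree (hE : H.edges.Nonempty) :
    H.outSignlessLaplacian.spectralRadius ≤ 2 * (H.maxOutDegree : ℝ) := by
  obtain ⟨c, hc, heq⟩ := (H.isGreatest_spectralRadius hE).1
  rw [heq]
  exact H.norm_le_two_mul_maxOutDegree hE (Hypermatrix.isEigenvalue_iff_mem_eigenvalueSet.1 hc)

theorem exists_isLeast_isGreatest (hE : H.edges.Nonempty) {S : Set ℝ} (hS : IsCompact S)
    (hsub : H.outSignlessLaplacian.eigenvalueSet ℝ ⊆ S)
    (hsup : ∀ c ∈ S, (c : ℂ) ∈ H.outSignlessLaplacian.eigenvalueSet ℂ) :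
    ∃ lmin lmax : ℝ, IsLeast S lmin ∧ IsGreatest S lmax ∧ 0 ≤ lmin ∧
      ((∃ i : V, H.outDegree i = H.minOutDegree ∧ H.NotTwoVertexHead i) →
        lmin ≤ (H.minOutDegree : ℝ)) ∧
      (H.minOutDegree : ℝ) ≤ (H.maxOutDegree : ℝ) ∧
      (H.maxOutDegree : ℝ) ≤ lmax ∧ lmax ≤ 2 * (H.maxOutDegree : ℝ) := by
  obtain ⟨i, hi⟩ := H.exists_outDegree_eq_maxOutDegree
  obtain ⟨c, hic, hc⟩ := H.exists_ge_outDegree_mem_eigenvalueSet hE i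
  obtain ⟨lmin, hmin⟩ := hS.exists_isLeast ⟨c, hsub hc⟩
  obtain ⟨lmax, hmax⟩ := hS.exists_isGreatest ⟨c, hsub hc⟩
  refine ⟨lmin, lmax, hmin, hmax, H.nonneg_of_mem_eigenvalueSet hE (hsup lmin hmin.1), ?_,
    Nat.cast_le.2 H.minOutDegree_le_maxOutDegree, hi ▸ hic.le.trans (hmax.2 (hsub hc)), ?_⟩
  · rintro ⟨j, hj, hhead⟩
    exact hj ▸ hmin.2 (hsub (H.outDegree_mem_eigenvalueSet hE hhead))
  · have hnorm := H.norm_le_two_mul_maxOutDegree hE (hsup lmax hmax.1)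
    rw [Complex.norm_real] at hnorm
    exact (Real.le_norm_self lmax).trans hnorm

theorem isHEigenvalue_zero (hE : H.edges.Nonempty) {m : ℕ} (hH : H.IsUniform m) (hm : Even m)
    {S : Finset V} (hS : ∀ e ∈ H.edges, Odd #(e.verts ∩ S)) :
    H.outSignlessLaplacian.IsHEigenvalue 0 := by
  obtain rfl := hH.eq_rank hE
  rw [Hypermatrix.isHEigenvalue_iff_mem_eigenvalueSet,
    H.outSignlessLaplacian_eq_signlessLaplacian hE]
  refine Hypermatrix.zero_mem_eigenvalueSet_signlessLaplacian (H.rank_ne_zero hE) hm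
    (x := fun v => if v ∈ S then -1 else 1) (fun v => ?_)
    fun p hp => H.prod_ite_neg_one_eq_neg_one hH hS hp
  split_ifs <;> norm_num

theorem isHEigenvalue_two_mul (hE : H.edges.Nonempty) {k : ℕ} (hk : H.IsOutRegular k) :
    H.outSignlessLaplacian.IsHEigenvalue (2 * k) :=
  Hypermatrix.isHEigenvalue_iff_mem_eigenvalueSet.2 <|
    Hypermatrix.mem_eigenvalueSet_of_rowSum_eq (c := 2 * k) fun i => by
      rw [H.rowSum_outSignlessLaplacian hE, hk i]

end SignlessLaplacian

end DirectedHypergraph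

theorem mainTheorem4_general {V : Type*} [Fintype V] [DecidableEq V] [Nonempty V]
    (H : DirectedHypergraph V) (hE : H.edges.Nonempty) :
    (∀ i : V, H.NotTwoVertexHead i →
      H.outSignlessLaplacian.IsEigenpair (H.outDegree i : ℂ) (Pi.single i 1)) ∧
    (IsGreatest H.outSignlessLaplacian.eigenvalueModuli H.outSignlessLaplacian.spectralRadius ∧
      2 * (H.minOutDegree : ℝ) ≤ H.outSignlessLaplacian.spectralRadius ∧
      H.outSignlessLaplacian.spectralRadius ≤ 2 * (H.maxOutDegree : ℝ)) ∧
    (∀ S : Set ℝ, (S = {c : ℝ | H.outSignlessLaplacian.IsEigenvalue (c : ℂ)} ∨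
        S = {c : ℝ | H.outSignlessLaplacian.IsHEigenvalue c}) →
      ∃ lmin lmax : ℝ, IsLeast S lmin ∧ IsGreatest S lmax ∧
        0 ≤ lmin ∧
        ((∃ i : V, H.outDegree i = H.minOutDegree ∧ H.NotTwoVertexHead i) →
          lmin ≤ (H.minOutDegree : ℝ)) ∧
        (H.minOutDegree : ℝ) ≤ (H.maxOutDegree : ℝ) ∧
        (H.maxOutDegree : ℝ) ≤ lmax ∧
        lmax ≤ 2 * (H.maxOutDegree : ℝ)) ∧
    (∀ m : ℕ, H.IsUniform m → Even m → (∃ S : Finset V, ∀ e ∈ H.edges, Odd #(e.verts ∩ S)) →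
      H.outSignlessLaplacian.IsHEigenvalue 0) ∧
    (∀ k : ℕ, H.IsOutRegular k → H.outSignlessLaplacian.IsHEigenvalue (2 * (k : ℝ))) := by
  have eigenvalue_of_hEigenvalue : ∀ c ∈ H.outSignlessLaplacian.eigenvalueSet ℝ,
      (c : ℂ) ∈ H.outSignlessLaplacian.eigenvalueSet ℂ := fun c hc =>
    Hypermatrix.isEigenvalue_iff_mem_eigenvalueSet.1
      (Hypermatrix.isHEigenvalue_iff_mem_eigenvalueSet.2 hc).isEigenvalue
  refine ⟨fun i hi => H.isEigenpair_outDegree_single hE hi,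
    ⟨H.isGreatest_spectralRadius hE, H.two_mul_minOutDegree_le_spectralRadius hE,
      H.spectralRadius_le_two_mul_maxOutDegree hE⟩, ?_,
    fun m hH hm ⟨S, hS⟩ => H.isHEigenvalue_zero hE hH hm hS,
    fun k hk => H.isHEigenvalue_two_mul hE hk⟩
  rintro S (rfl | rfl)
  · simp only [Hypermatrix.isEigenvalue_iff_mem_eigenvalueSet]
    exact H.exists_isLeast_isGreatest hE (Complex.isometry_ofReal.isClosedEmbedding
      |>.isCompact_preimage (Hypermatrix.isCompact_eigenvalueSet _)) eigenvalue_of_hEigenvalue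
      fun _ hc => hc
  · simp only [Hypermatrix.isHEigenvalue_iff_mem_eigenvalueSet]
    exact H.exists_isLeast_isGreatest hE (Hypermatrix.isCompact_eigenvalueSet _) subset_rfl
      eigenvalue_of_hEigenvalue

theorem mainTheorem4 {V : Type*} [Fintype V] [DecidableEq V] [Nonempty V]
    (H : DirectedHypergraph V) (hE : H.edges.Nonempty) :
    -- (i)
    (3 ≤ H.rank → ∀ i : V, H.NotTwoVertexHead i →
      H.outSignlessLaplacian.IsEigenpair (H.outDegree i : ℂ) (Pi.single i 1)) ∧
    -- (ii)
    (IsGreatest H.outSignlessLaplacian.eigenvalueModuli H.outSignlessLaplacian.spectralRadius ∧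
      2 * (H.minOutDegree : ℝ) ≤ H.outSignlessLaplacian.spectralRadius ∧
      H.outSignlessLaplacian.spectralRadius ≤ 2 * (H.maxOutDegree : ℝ)) ∧
    -- (iii), for the set of all real eigenvalues and for the set of all H-eigenvalues
    (3 ≤ H.rank →
      ∀ S : Set ℝ, (S = {c : ℝ | H.outSignlessLaplacian.IsEigenvalue (c : ℂ)} ∨
          S = {c : ℝ | H.outSignlessLaplacian.IsHEigenvalue c}) →
        ∃ lmin lmax : ℝ, IsLeast S lmin ∧ IsGreatest S lmax ∧
          0 ≤ lmin ∧
          ((∃ i : V, H.outDegree i = H.minOutDegree ∧ H.NotTwoVertexHead i) →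
            lmin ≤ (H.minOutDegree : ℝ)) ∧
          (H.minOutDegree : ℝ) ≤ (H.maxOutDegree : ℝ) ∧
          (H.maxOutDegree : ℝ) ≤ lmax ∧
          lmax ≤ 2 * (H.maxOutDegree : ℝ)) ∧
    -- (iv)
    (∀ m : ℕ, H.IsUniform m → Even m → (∃ v : V, ∀ e ∈ H.edges, v ∈ e.verts) →
      H.outSignlessLaplacian.IsEigenvalue 0) ∧
    -- (v)
    (∀ k : ℕ, H.IsOutRegular k → H.outSignlessLaplacian.IsEigenvalue (2 * (k : ℂ))) := by
  obtain ⟨single, radius, extremes, zero, regular⟩ := mainTheorem4_general H hE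
  exact ⟨fun _ => single, radius, fun _ => extremes,
    fun m hH hm ⟨v, hv⟩ => mod_cast
      (zero m hH hm ⟨{v}, fun e he => by simp [hv e he]⟩).isEigenvalue,
    fun k hk => mod_cast (regular k hk).isEigenvalue⟩
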